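/- Let $M$ be a three-dimensional strictly pseudoconvex CR manifold and $p\in M$. A formal holomorphic embedding $Z=(z,w)$ of $M$ at $p$ into $\mathbb C^2$ (a pair of formal CR functions at $p$ vanishing at $p$, whose real differential at $p$ is injective) is called a Chern–Moser normal coordinate system for $M$ at $p$ if on $M$, in the sense of formal power series at $p$, $$\operatorname{Im} w=|z|^2+\sum_{k,l\ge 2}A_{kl}(z,\bar z,\operatorname{Re} w),\qquad A_{kl}=\overline{A_{lk}},\qquad A_{22}=A_{23}=A_{33}=0,$$ where $A_{kl}(z,\bar z,s)=a_{kl}(s)\,z^k\bar z^l$ with $a_{kl}\in\mathbb C[[s]]$. Put $c_{2,4}:=a_{24}(0)$, so that the terms of $A_{24}+A_{42}$ at $s=0$ are $2\operatorname{Re}(c_{2,4}z^2\bar z^4)$. Let $Z=(z,w)$ and $Z^*=(z^*,w^*)$ be two Chern–Moser normal coordinate systems for $M$ at $p$, with coefficients $c_{2,4}$ and $c^*_{2,4}$, and let $H$ be a formal biholomorphic transformation of $(\mathbb C^2,0)$ (a pair of formal power series in two variables without constant terms, whose Jacobian matrix $H_Z(0)$ is invertible) such that $Z^*=H(Z)$.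 Then $$c_{2,4}=(\det H_Z(0))^{-1/3}\;\overline{(\det H_Z(0))}^{\,5/3}\;c^*_{2,4},$$ where the fractional powers are formed with one common branch of the logarithm: for every $\ell\in\mathbb C$ with $e^{\ell}=\det H_Z(0)$, $$c_{2,4}=e^{-\ell/3}\,e^{5\bar\ell/3}\,c^*_{2,4}.$$ In particular, $c_{2,4}=0$ if and only if $c^*_{2,4}=0$. -/

import Mathlib

/-- Complex conjugate of a formal power series in real variables: the variables are real,
so only the coefficients are conjugated. -/
noncomputable def formalConj (f : MvPowerSeries (Fin 3) ℂ) : MvPowerSeries (Fin 3) ℂ :=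
  MvPowerSeries.map (starRingEnd ℂ) f

/-- Real part `(f + f̄) / 2`. -/
noncomputable def formalRe (f : MvPowerSeries (Fin 3) ℂ) : MvPowerSeries (Fin 3) ℂ :=
  (1 / 2 : ℂ) • (f + formalConj f)

/-- Imaginary part `(f - f̄) / (2i)`. -/
noncomputable def formalIm (f : MvPowerSeries (Fin 3) ℂ) : MvPowerSeries (Fin 3) ℂ :=
  (1 / (2 * Complex.I) : ℂ) • (f - formalConj f)

/-- The formal complex vector field `V = ∑ V_j ∂/∂x_j` applied to a formal function. -/
noncomputable def formalVectorApply (V : Fin 3 → MvPowerSeries (Fin 3) ℂ)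
    (f : MvPowerSeries (Fin 3) ℂ) : MvPowerSeries (Fin 3) ℂ :=
  ∑ j, V j * MvPowerSeries.pderiv ℂ j f

/-- The Lie bracket of two formal complex vector fields. -/
noncomputable def formalBracket (V W : Fin 3 → MvPowerSeries (Fin 3) ℂ) :
    Fin 3 → MvPowerSeries (Fin 3) ℂ :=
  fun j => formalVectorApply V (W j) - formalVectorApply W (V j)

/-- The value at the base point of a formal complex vector field. -/
noncomputable def formalValueAt (V : Fin 3 → MvPowerSeries (Fin 3) ℂ) : Fin 3 → ℂ :=
  fun j => MvPowerSeries.constantCoeff (V j)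

/-- The formal germ at a point `p` of a three-dimensional strictly pseudoconvex CR manifold, in
real local coordinates `x = (x₀, x₁, x₂)` centred at `p`: the CR structure is spanned by a formal
`(0,1)` vector field `L̄`, and `L`, `L̄`, `[L, L̄]` span the complexified tangent space at `p`
(the Levi form is non-zero, which in this dimension is strict pseudoconvexity). Every smooth
strictly pseudoconvex CR three-manifold gives such a germ at each of its points by Taylor
expansion. -/
structure FormalCRGerm where
  /-- The `(0,1)` vector field spanning the CR structure. -/
  Lbar : Fin 3 → MvPowerSeries (Fin 3) ℂ
  strictlyPseudoconvex :
    LinearIndependent ℂ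
      ![formalValueAt (fun j => formalConj (Lbar j)),
        formalValueAt Lbar,
        formalValueAt (formalBracket (fun j => formalConj (Lbar j)) Lbar)]

/-- `Z = (z, w) = (Z 0, Z 1)` is a formal holomorphic embedding of `M` into `ℂ²` sending the
base point to `0`: both components are formal CR functions, and the real differential of `Z` at
the base point is injective. -/
structure IsFormalEmbedding (M : FormalCRGerm) (Z : Fin 2 → MvPowerSeries (Fin 3) ℂ) : Prop where
  map_base : ∀ i, MvPowerSeries.constantCoeff (Z i) = 0
  cr : ∀ i, formalVectorApply M.Lbar (Z i) = 0
  immersion : LinearIndependent ℝ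
    (fun (j : Fin 3) (i : Fin 2) => MvPowerSeries.coeff (Finsupp.single j 1) (Z i))

/-- The family `A k l ∈ ℂ⟦s⟧` encodes the terms `A_{kl}(z, z̄, s) = (A k l)(s) z^k z̄^l`.
The family is in Chern–Moser normal form if only terms with `k, l ≥ 2` occur, `A_{kl}` is the
conjugate of `A_{lk}`, and `A_{22} = A_{23} = A_{33} = 0`. -/
structure IsChernMoserNormalForm (A : ℕ → ℕ → PowerSeries ℂ) : Prop where
  zero_of_lt : ∀ k l, (k < 2 ∨ l < 2) → A k l = 0
  conj_symm : ∀ k l, A k l = PowerSeries.map (starRingEnd ℂ) (A l k)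
  A22 : A 2 2 = 0
  A23 : A 2 3 = 0
  A33 : A 3 3 = 0

/-- The formal series `∑_{k,l} (A k l)(s) z^k z̄^l` in the three variables
`(z, z̄, s) = (X 0, X 1, X 2)`. -/
noncomputable def graphSeries (A : ℕ → ℕ → PowerSeries ℂ) : MvPowerSeries (Fin 3) ℂ :=
  fun n => PowerSeries.coeff (n 2) (A (n 0) (n 1))

/-- `Z = (z, w)` is a Chern–Moser normal coordinate system for `M` at its base point, with normal
form `Im w = |z|² + ∑_{k,l ≥ 2} A_{kl}(z, z̄, Re w)`. -/
structure IsChernMoserCoordinates (M : FormalCRGerm) (Z : Fin 2 → MvPowerSeries (Fin 3) ℂ)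
    (A : ℕ → ℕ → PowerSeries ℂ) : Prop where
  embedding : IsFormalEmbedding M Z
  normalForm : IsChernMoserNormalForm A
  equation : formalIm (Z 1) = Z 0 * formalConj (Z 0) +
    MvPowerSeries.subst ![Z 0, formalConj (Z 0), formalRe (Z 1)] (graphSeries A)

/-- The coefficient `c_{2,4}` of `z² z̄⁴` in the normal form, that is
`A_{24}(z, z̄, 0) + A_{42}(z, z̄, 0) = 2 Re (c_{2,4} z² z̄⁴)`. -/
noncomputable def cartanCoeff (A : ℕ → ℕ → PowerSeries ℂ) : ℂ :=
  PowerSeries.constantCoeff (A 2 4)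

/-- The Jacobian matrix `H_Z(0)` of a formal holomorphic map `H`. -/
noncomputable def formalJacobian (H : Fin 2 → MvPowerSeries (Fin 2) ℂ) :
    Matrix (Fin 2) (Fin 2) ℂ :=
  Matrix.of fun i j => MvPowerSeries.coeff (Finsupp.single j 1) (H i)

/-- `H` is a formal biholomorphic transformation of `(ℂ², 0)`: it fixes the origin and its
Jacobian at the origin is invertible. -/
structure IsFormalBiholomorphism (H : Fin 2 → MvPowerSeries (Fin 2) ℂ) : Prop where
  map_zero : ∀ i, MvPowerSeries.constantCoeff (H i) = 0
  det_ne_zero : (formalJacobian H).det ≠ 0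

/-!
The parameters `(z, z̄, Re w)` are formal coordinates on `M`, so a power series identity in them is
an identity between formal power series in three independent variables `(z, ζ, s)`
(`eq_zero_of_subst_eq_zero_of_isUnit_det`, `isUnit_det_graphParam`). Writing `H = (f, g)` and
`N`, `N*` for the higher order terms of the two normal forms, the transformation law becomes

  `g(z, w) - ḡ(ζ, w̄) = 2i f(z, w) f̄(ζ, w̄) + 2i N*(f, f̄, (g + ḡ) / 2)`,

where `w = s + i(zζ + N)`, `w̄ = s - i(zζ + N)`, and it may be evaluated along any formal family of
points (`graphDefect_eq_zero`).

It is evaluated at `s = i z ζ`, modulo `(z³, ζ⁵)`. As `A₂₂ = A₂₃ = 0`, one has `N = c z²ζ⁴` there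
(`toTrunc_subst_graphSeries`), so that `w = 2i zζ + i c z²ζ⁴` and `w̄ = -i c z²ζ⁴`. Only the
`2`-jet of `H` and the coefficients `b_j` of `ζ^j` in `f̄(ζ, 0)` contribute to the terms divisible
by `z`, and comparison of coefficients (`relations_of_graphDefect_eq_zero`), with `λ = f₁₀`, gives

* at `z` and `zζ`: `g₁₀ = 0` and `g₀₁ = λ λ̄`, so that `det H_Z(0) = λ² λ̄`;
* at `z ζ^j`, `j = 2, 3, 4`: `λ b_j = -2i f₀₁ b_{j-1}`, so the `b_j` are in geometric progression;
* at `z²ζ³`: `f₂₀ b₃ + 2i f₁₁ b₂ - 4 f₀₂ b₁ = 0`;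
* at `z²ζ⁴`: `c λ λ̄ = (f₂₀ b₄ + 2i f₁₁ b₃ - 4 f₀₂ b₂) + c* λ² λ̄⁴`.

By the geometric progression the bracket in the last equation is a multiple of the left side of the
one before, hence zero. Thus `c = λ λ̄³ c*`, and `λ λ̄³` is the asserted product of powers of
`det H_Z(0)` and its conjugate (`exp_mul_exp_of_exp_eq`).
-/

/-! ### Injectivity of formal substitutions -/

namespace MvPowerSeries

section Injectivity

variable {σ : Type*} {R : Type*} [CommRing R]

theorem homogeneousComponent_pow_of_one_le_order {f : MvPowerSeries σ R} (hf : 1 ≤ f.order)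
    (k : ℕ) :
    (k : ℕ∞) ≤ (f ^ k).order ∧
      homogeneousComponent k (f ^ k) = homogeneousComponent 1 f ^ k := by
  induction k with
  | zero =>
    refine ⟨by simp, ?_⟩
    classical
    ext d
    rw [pow_zero, pow_zero, coeff_homogeneousComponent, coeff_one]
    split_ifs with h1 h2 h2
    · rfl
    · rfl
    · exact absurd (by simp [h2]) h1
    · rfl
  | succ k ih =>
    have h1 : ((1 : ℕ) : ℕ∞) ≤ f.order := by exact_mod_cast hf
    constructor
    · rw [pow_succ, Nat.cast_add]
      exact (add_le_add ih.1 h1).trans le_order_mul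
    · rw [pow_succ, pow_succ, homogeneousComponent_mul_of_le_order ih.1 h1, ih.2]

theorem homogeneousComponent_prod_pow {v : σ → MvPowerSeries σ R}
    (hv : ∀ i, 1 ≤ (v i).order) (n : σ → ℕ) (s : Finset σ) :
    ((∑ i ∈ s, n i : ℕ) : ℕ∞) ≤ (∏ i ∈ s, v i ^ n i).order ∧
      homogeneousComponent (∑ i ∈ s, n i) (∏ i ∈ s, v i ^ n i) =
        ∏ i ∈ s, homogeneousComponent 1 (v i) ^ n i := by
  classical
  induction s using Finset.induction_on with
  | empty =>
    have := homogeneousComponent_pow_of_one_le_order (f := (0 : MvPowerSeries σ R)) (by simp) 0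
    simpa using this
  | insert i s hi ih =>
    rw [Finset.sum_insert hi, Finset.prod_insert hi, Finset.prod_insert hi]
    have h1 := homogeneousComponent_pow_of_one_le_order (hv i) (n i)
    refine ⟨?_, ?_⟩
    · rw [Nat.cast_add]
      exact (add_le_add h1.1 ih.1).trans le_order_mul
    · rw [homogeneousComponent_mul_of_le_order h1.1 ih.1, h1.2, ih.2]

/-- A substitution `v` with `v i = X i + O(2)` does not change the lowest-order part of a power
series, so it is injective. -/
theorem eq_zero_of_subst_eq_zero_of_homogeneousComponent_eq_X [Finite σ]
    {v : σ → MvPowerSeries σ R} (hv0 : ∀ i, constantCoeff (v i) = 0)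
    (hv1 : ∀ i, homogeneousComponent 1 (v i) = X i) {F : MvPowerSeries σ R}
    (hF : subst v F = 0) : F = 0 := by
  classical
  have hs : HasSubst v := hasSubst_of_constantCoeff_zero hv0
  have hv : ∀ i, 1 ≤ (v i).order := fun i => one_le_order_iff_constCoeff_eq_zero.2 (hv0 i)
  suffices h : ∀ k, ∀ e : σ →₀ ℕ, e.degree = k → coeff e F = 0 by
    ext e
    exact h _ e rfl
  intro k
  induction k using Nat.strong_induction_on with
  | _ k ih =>
  intro e he
  have hkey : ∀ d : σ →₀ ℕ, k ≤ d.degree →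
      coeff e (d.prod fun i m => v i ^ m) = if d = e then 1 else 0 := by
    intro d hd
    obtain ⟨h1, h2⟩ := homogeneousComponent_prod_pow hv d d.support
    have hdeg : ∑ i ∈ d.support, d i = d.degree := rfl
    rw [hdeg] at h1 h2
    rcases hd.lt_or_eq with hlt | heq
    · rw [if_neg (by rintro rfl; omega)]
      exact coeff_of_lt_order (lt_of_lt_of_le (by rw [he]; exact_mod_cast hlt) h1)
    · have h3 := congrArg (coeff e) h2
      rw [coeff_homogeneousComponent, if_pos (by omega)] at h3
      rw [Finsupp.prod, h3]
      simp only [hv1]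
      have h4 : ∏ i ∈ d.support, (X i : MvPowerSeries σ R) ^ d i = monomial d 1 := by
        rw [monomial_one_eq]; rfl
      rw [h4, coeff_monomial]
      simp only [eq_comm]
  have h := congrArg (coeff e) hF
  rw [coeff_subst hs, finsum_eq_single _ e, hkey e he.ge] at h
  · simpa using h
  · intro d hd
    rcases lt_or_ge d.degree k with hlt | hge
    · rw [ih _ hlt d rfl, zero_smul]
    · rw [hkey d hge, if_neg hd, smul_zero]

/-- The formal inverse function theorem, in its weak form: a substitution with invertible Jacobian
matrix is injective. -/
theorem eq_zero_of_subst_eq_zero_of_isUnit_det [Fintype σ] [DecidableEq σ]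
    {u : σ → MvPowerSeries σ R} (hu0 : ∀ i, constantCoeff (u i) = 0)
    (hu : IsUnit (Matrix.of fun i j => coeff (Finsupp.single j 1) (u i)).det)
    {F : MvPowerSeries σ R} (hF : subst u F = 0) : F = 0 := by
  set U : Matrix σ σ R := Matrix.of fun i j => coeff (Finsupp.single j 1) (u i) with hU
  have hUV : U * U⁻¹ = 1 := Matrix.mul_nonsing_inv _ hu
  have hVU : U⁻¹ * U = 1 := Matrix.nonsing_inv_mul _ hu
  let lin : Matrix σ σ R → σ → MvPowerSeries σ R := fun B i => ∑ j, C (B i j) * X j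
  have hlin0 : ∀ B i, constantCoeff (lin B i) = 0 := by intro B i; simp [lin]
  have hlin : ∀ B, HasSubst (lin B) := fun B => hasSubst_of_constantCoeff_zero (hlin0 B)
  have hsub : ∀ {b : σ → MvPowerSeries σ R} (hb : HasSubst b) (B : Matrix σ σ R) (i : σ),
      subst b (lin B i) = ∑ j, C (B i j) * b j := by
    intro b hb B i
    simp only [lin]
    rw [← coe_substAlgHom hb, map_sum]
    refine Finset.sum_congr rfl fun j _ => ?_
    rw [map_mul, coe_substAlgHom, subst_C, subst_X hb]
  have hmul : ∀ (b : σ → MvPowerSeries σ R) (B B' : Matrix σ σ R), B * B' = 1 → ∀ i,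
      ∑ j, C (B i j) * ∑ k, C (B' j k) * b k = b i := by
    intro b B B' hB i
    simp only [Finset.mul_sum, ← mul_assoc, ← map_mul]
    rw [Finset.sum_comm]
    simp only [← Finset.sum_mul, ← map_sum, ← Matrix.mul_apply, hB]
    rw [Finset.sum_eq_single i]
    · simp
    · intro k _ hk
      simp [Matrix.one_apply_ne hk.symm]
    · simp
  -- `v` straightens the linear part of `u`, and `u` is recovered from it linearly
  let v : σ → MvPowerSeries σ R := fun i => ∑ j, C (U⁻¹ i j) * u j
  have hv0 : ∀ i, constantCoeff (v i) = 0 := by intro i; simp [v, hu0]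
  have hvs : HasSubst v := hasSubst_of_constantCoeff_zero hv0
  have hv1 : ∀ i, homogeneousComponent 1 (v i) = X i := by
    intro i
    ext e
    rw [coeff_homogeneousComponent, coeff_X]
    split_ifs with h1 h2 h2
    · subst h2
      simp only [v, map_sum, coeff_C_mul]
      change ∑ j, U⁻¹ i j * U j i = 1
      rw [← Matrix.mul_apply, hVU, Matrix.one_apply_eq]
    · obtain ⟨k, rfl⟩ := (Finsupp.sum_eq_one_iff e).1 h1
      simp only [v, map_sum, coeff_C_mul]
      change ∑ j, U⁻¹ i j * U j k = 0
      rw [← Matrix.mul_apply, hVU, Matrix.one_apply_ne]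
      rintro rfl
      exact h2 rfl
    · exact absurd (by simp [h2]) h1
    · rfl
  have h1 : subst v (subst (lin U) F) = 0 := by
    rw [subst_comp_subst_apply (hlin U) hvs, ← hF]
    congr 1
    funext i
    rw [hsub hvs]
    exact hmul u U U⁻¹ hUV i
  have h2 := eq_zero_of_subst_eq_zero_of_homogeneousComponent_eq_X hv0 hv1 h1
  have h3 : subst (lin U⁻¹) (subst (lin U) F) = F := by
    rw [subst_comp_subst_apply (hlin U) (hlin _)]
    have : (fun i => subst (lin U⁻¹) (lin U i)) = (X : σ → MvPowerSeries σ R) := by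
      funext i
      rw [hsub (hlin _)]
      exact hmul X U U⁻¹ hUV i
    rw [this, subst_self]
    rfl
  rw [← h3, h2, ← coe_substAlgHom (hlin _), map_zero]

end Injectivity

end MvPowerSeries

/-! ### The complexified transformation law -/

open MvPowerSeries in
/-- The holomorphic coordinate `w = s + i (z ζ + N(z, ζ, s))` on the complexified hypersurface, at
the point with parameters `(z, ζ, s) = a`; here `ζ` stands for `z̄` and `N = graphSeries A`. -/
noncomputable def graphCoord {τ : Type*} (A : ℕ → ℕ → PowerSeries ℂ)
    (a : Fin 3 → MvPowerSeries τ ℂ) : MvPowerSeries τ ℂ :=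
  a 2 + C Complex.I * (a 0 * a 1 + subst a (graphSeries A))

open MvPowerSeries in
/-- The complexification `s - i (z ζ + N(z, ζ, s))` of `w̄`, at the point with parameters
`(z, ζ, s) = a`. -/
noncomputable def graphCoordConj {τ : Type*} (A : ℕ → ℕ → PowerSeries ℂ)
    (a : Fin 3 → MvPowerSeries τ ℂ) : MvPowerSeries τ ℂ :=
  a 2 - C Complex.I * (a 0 * a 1 + subst a (graphSeries A))

open MvPowerSeries in
/-- The complexification of `2i (Im w* - |z*|² - N*(z*, z̄*, Re w*))`, where `(z*, w*) = H(z, w)`,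
at the point of the complexified hypersurface with parameters `(z, ζ, s) = a`. -/
noncomputable def graphDefect {τ : Type*} (H : Fin 2 → MvPowerSeries (Fin 2) ℂ)
    (A Astar : ℕ → ℕ → PowerSeries ℂ) (a : Fin 3 → MvPowerSeries τ ℂ) : MvPowerSeries τ ℂ :=
  let h := fun i => subst ![a 0, graphCoord A a] (H i)
  let k := fun i => subst ![a 1, graphCoordConj A a] (map (starRingEnd ℂ) (H i))
  h 1 - k 1 - C (2 * Complex.I) * (h 0 * k 0 +
    subst ![h 0, k 0, C (1 / 2) * (h 1 + k 1)] (graphSeries Astar))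

namespace MvPowerSeries

theorem hasSubst_pair {τ : Type*} {x y : MvPowerSeries τ ℂ} (hx : constantCoeff x = 0)
    (hy : constantCoeff y = 0) : HasSubst ![x, y] :=
  hasSubst_of_constantCoeff_zero (by intro i; fin_cases i <;> simpa)

theorem hasSubst_triple {τ : Type*} {x y t : MvPowerSeries τ ℂ} (hx : constantCoeff x = 0)
    (hy : constantCoeff y = 0) (ht : constantCoeff t = 0) : HasSubst ![x, y, t] :=
  hasSubst_of_constantCoeff_zero (by intro i; fin_cases i <;> simpa)

theorem constantCoeff_subst_pair {τ : Type*} {x y : MvPowerSeries τ ℂ}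
    (hx : constantCoeff x = 0) (hy : constantCoeff y = 0) {F : MvPowerSeries (Fin 2) ℂ}
    (hF : constantCoeff F = 0) : constantCoeff (subst ![x, y] F) = 0 :=
  constantCoeff_subst_eq_zero (hasSubst_pair hx hy) (by intro i; fin_cases i <;> simpa) hF

theorem subst_subst_pair {τ υ : Type*} {x y : MvPowerSeries τ ℂ} (hx : constantCoeff x = 0)
    (hy : constantCoeff y = 0) {b : τ → MvPowerSeries υ ℂ} (hb : HasSubst b)
    (F : MvPowerSeries (Fin 2) ℂ) :
    subst b (subst ![x, y] F) = subst ![subst b x, subst b y] F := by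
  rw [subst_comp_subst_apply (hasSubst_pair hx hy) hb]
  congr 1
  funext i
  fin_cases i <;> rfl

theorem subst_subst_triple {τ υ : Type*} {x y t : MvPowerSeries τ ℂ}
    (hx : constantCoeff x = 0) (hy : constantCoeff y = 0) (ht : constantCoeff t = 0)
    {b : τ → MvPowerSeries υ ℂ} (hb : HasSubst b) (F : MvPowerSeries (Fin 3) ℂ) :
    subst b (subst ![x, y, t] F) = subst ![subst b x, subst b y, subst b t] F := by
  rw [subst_comp_subst_apply (hasSubst_triple hx hy ht) hb]
  congr 1
  funext i
  fin_cases i <;> rfl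

end MvPowerSeries

open MvPowerSeries

section Defect

variable {A Astar : ℕ → ℕ → PowerSeries ℂ} {H : Fin 2 → MvPowerSeries (Fin 2) ℂ}

theorem constantCoeff_graphSeries (hA : IsChernMoserNormalForm A) :
    constantCoeff (graphSeries A) = 0 := by
  change PowerSeries.coeff 0 (A 0 0) = 0
  rw [hA.zero_of_lt 0 0 (by norm_num), map_zero]

theorem constantCoeff_graphCoord (hA : IsChernMoserNormalForm A) {τ : Type*}
    {a : Fin 3 → MvPowerSeries τ ℂ} (ha : ∀ i, constantCoeff (a i) = 0) :
    constantCoeff (graphCoord A a) = 0 ∧ constantCoeff (graphCoordConj A a) = 0 := by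
  have h := constantCoeff_subst_eq_zero (hasSubst_of_constantCoeff_zero ha) ha
    (constantCoeff_graphSeries hA)
  simp [graphCoord, graphCoordConj, ha, h]

theorem subst_graphCoord {τ υ : Type*} {a : Fin 3 → MvPowerSeries τ ℂ}
    (ha : ∀ i, constantCoeff (a i) = 0) {b : τ → MvPowerSeries υ ℂ} (hb : HasSubst b) :
    subst b (graphCoord A a) = graphCoord A (fun i => subst b (a i)) ∧
      subst b (graphCoordConj A a) = graphCoordConj A (fun i => subst b (a i)) := by
  have h := subst_comp_subst_apply (hasSubst_of_constantCoeff_zero ha) hb (graphSeries A)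
  simp only [graphCoord, graphCoordConj, ← h, subst_add hb, subst_sub hb, subst_mul hb,
    subst_C, and_self]

/-- The defect is natural with respect to substitutions of the parameters. -/
theorem subst_graphDefect (hA : IsChernMoserNormalForm A)
    (hH : ∀ i, constantCoeff (H i) = 0) {τ υ : Type*} {a : Fin 3 → MvPowerSeries τ ℂ}
    (ha : ∀ i, constantCoeff (a i) = 0) {b : τ → MvPowerSeries υ ℂ} (hb : HasSubst b) :
    subst b (graphDefect H A Astar a) = graphDefect H A Astar (fun i => subst b (a i)) := by
  obtain ⟨hw, hw'⟩ := constantCoeff_graphCoord hA ha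
  obtain ⟨sw, sw'⟩ := subst_graphCoord (A := A) ha hb
  have hH' : ∀ i, constantCoeff (map (starRingEnd ℂ) (H i)) = 0 := by
    intro i; simp [hH]
  have h0 := fun i => constantCoeff_subst_pair (ha 0) hw (hH i)
  have k0 := fun i => constantCoeff_subst_pair (ha 1) hw' (hH' i)
  have ht : constantCoeff (C (1 / 2) * (subst ![a 0, graphCoord A a] (H 1) +
      subst ![a 1, graphCoordConj A a] (map (starRingEnd ℂ) (H 1)))) = 0 := by
    rw [map_mul, map_add, h0, k0]; simp
  simp only [graphDefect, subst_add hb, subst_sub hb, subst_mul hb, subst_C,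
    subst_subst_triple (h0 0) (k0 0) ht hb, subst_subst_pair (ha 0) hw hb,
    subst_subst_pair (ha 1) hw' hb, sw, sw']

end Defect

section CRGerm

variable {M : FormalCRGerm} {Z Zstar : Fin 2 → MvPowerSeries (Fin 3) ℂ}
  {A Astar : ℕ → ℕ → PowerSeries ℂ}

/-- The real parameters `(z, z̄, Re w)` of the hypersurface, as formal functions on `M`. -/
noncomputable def graphParam (Z : Fin 2 → MvPowerSeries (Fin 3) ℂ) :
    Fin 3 → MvPowerSeries (Fin 3) ℂ :=
  ![Z 0, formalConj (Z 0), formalRe (Z 1)]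

theorem constantCoeff_formalConj {f : MvPowerSeries (Fin 3) ℂ} (hf : constantCoeff f = 0) :
    constantCoeff (formalConj f) = 0 := by
  simp [formalConj, hf]

theorem constantCoeff_formalRe {f : MvPowerSeries (Fin 3) ℂ} (hf : constantCoeff f = 0) :
    constantCoeff (formalRe f) = 0 := by
  rw [formalRe, smul_eq_C_mul, map_mul, map_add, constantCoeff_formalConj hf, hf]
  simp

theorem constantCoeff_graphParam (hZ : ∀ i, constantCoeff (Z i) = 0) (i : Fin 3) :
    constantCoeff (graphParam Z i) = 0 := by
  fin_cases i
  · exact hZ 0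
  · exact constantCoeff_formalConj (hZ 0)
  · exact constantCoeff_formalRe (hZ 1)

theorem formalRe_add_I_mul_formalIm (f : MvPowerSeries (Fin 3) ℂ) :
    formalRe f + C Complex.I * formalIm f = f ∧
      formalRe f - C Complex.I * formalIm f = formalConj f := by
  have hI := Complex.I_ne_zero
  constructor <;> ext n <;>
    simp only [formalRe, formalIm, map_add, map_sub, coeff_C_mul, coeff_smul] <;> field_simp <;>
    ring

theorem IsChernMoserCoordinates.graphCoord_eq (hZ : IsChernMoserCoordinates M Z A) :
    graphCoord A (graphParam Z) = Z 1 ∧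
      graphCoordConj A (graphParam Z) = formalConj (Z 1) := by
  have h := formalRe_add_I_mul_formalIm (Z 1)
  rw [hZ.equation] at h
  exact h

theorem two_I_mul_formalIm (f : MvPowerSeries (Fin 3) ℂ) :
    C (2 * Complex.I) * formalIm f = f - formalConj f := by
  have h := formalRe_add_I_mul_formalIm f
  rw [map_mul, ← h.2]
  nth_rw 2 [← h.1]
  rw [show (C 2 : MvPowerSeries (Fin 3) ℂ) = 2 from rfl]
  ring

/-- On `M` the defect vanishes, since `Z* = H(Z)` satisfies its own normal form equation. -/
theorem graphDefect_graphParam {H : Fin 2 → MvPowerSeries (Fin 2) ℂ}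
    (hZ : IsChernMoserCoordinates M Z A) (hZstar : IsChernMoserCoordinates M Zstar Astar)
    (hHZ : ∀ i, Zstar i = subst Z (H i)) :
    graphDefect H A Astar (graphParam Z) = 0 := by
  have hZ0 := hZ.embedding.map_base
  have h1 : ∀ i, subst ![graphParam Z 0, graphCoord A (graphParam Z)] (H i) = Zstar i := by
    intro i
    rw [hZ.graphCoord_eq.1, hHZ]
    congr 1
    funext j
    fin_cases j <;> rfl
  have h2 : ∀ i, subst ![graphParam Z 1, graphCoordConj A (graphParam Z)]
      (map (starRingEnd ℂ) (H i)) = formalConj (Zstar i) := by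
    intro i
    rw [hZ.graphCoord_eq.2, hHZ, formalConj, formalConj,
      map_subst (hasSubst_of_constantCoeff_zero hZ0)]
    congr 1
    funext j
    fin_cases j <;> rfl
  have h3 : C (1 / 2) * (Zstar 1 + formalConj (Zstar 1)) = formalRe (Zstar 1) := by
    rw [formalRe, smul_eq_C_mul]
  simp only [graphDefect, h1, h2, h3]
  rw [← hZstar.equation, two_I_mul_formalIm, sub_self]

end CRGerm

/-! ### The parameters as formal coordinates -/

section Jacobian
variable {M : FormalCRGerm} {Z Zstar : Fin 2 → MvPowerSeries (Fin 3) ℂ}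
  {A Astar : ℕ → ℕ → PowerSeries ℂ} {H : Fin 2 → MvPowerSeries (Fin 2) ℂ}

theorem coeff_single_mul_of_constantCoeff_eq_zero {τ : Type*} {x y : MvPowerSeries τ ℂ}
    (hx : constantCoeff x = 0) (hy : constantCoeff y = 0) (j : τ) :
    coeff (Finsupp.single j 1) (x * y) = 0 := by
  apply coeff_of_lt_order
  have hx' := one_le_order_iff_constCoeff_eq_zero.2 hx
  have hy' := one_le_order_iff_constCoeff_eq_zero.2 hy
  refine lt_of_lt_of_le ?_ ((add_le_add hx' hy').trans le_order_mul)
  rw [Finsupp.degree_single]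
  norm_num

theorem coeff_single_subst_graphSeries (hA : IsChernMoserNormalForm A) {τ : Type*}
    {a : Fin 3 → MvPowerSeries τ ℂ} (ha : ∀ i, constantCoeff (a i) = 0) (j : τ) :
    coeff (Finsupp.single j 1) (subst a (graphSeries A)) = 0 := by
  rw [coeff_subst (hasSubst_of_constantCoeff_zero ha)]
  refine finsum_eq_zero_of_forall_eq_zero fun d => ?_
  by_cases hd : d 0 < 2 ∨ d 1 < 2
  · have : coeff d (graphSeries A) = 0 := by
      change PowerSeries.coeff (d 2) (A (d 0) (d 1)) = 0
      rw [hA.zero_of_lt _ _ hd, map_zero]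
    rw [this, zero_smul]
  · push Not at hd
    rw [Finsupp.prod_fintype _ _ (fun _ => pow_zero _), Fin.prod_univ_three,
      mul_assoc, coeff_single_mul_of_constantCoeff_eq_zero, smul_zero]
    · rw [map_pow, ha, zero_pow (by omega)]
    · rw [map_mul, map_pow, ha, zero_pow (by omega), zero_mul]

/-- The parameters `(z, z̄, Re w)` are formal coordinates: `Im w` has no linear part, so the
injectivity of the real differential of `(z, w)` gives that of the complexified differential of
`(z, z̄, Re w)`. -/
theorem isUnit_det_graphParam (hZ : IsChernMoserCoordinates M Z A) :
    IsUnit (Matrix.of fun i j => coeff (Finsupp.single j 1) (graphParam Z i)).det := by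
  have hZ0 := hZ.embedding.map_base
  have him : ∀ j, coeff (Finsupp.single j 1) (formalIm (Z 1)) = 0 := by
    intro j
    rw [hZ.equation, map_add, coeff_single_mul_of_constantCoeff_eq_zero (hZ0 0)
      (constantCoeff_formalConj (hZ0 0)), zero_add]
    exact coeff_single_subst_graphSeries hZ.normalForm (constantCoeff_graphParam hZ0) j
  have hconj : ∀ j, (starRingEnd ℂ) (coeff (Finsupp.single j 1) (Z 1)) =
      coeff (Finsupp.single j 1) (Z 1) := by
    intro j
    have h := congrArg (coeff (Finsupp.single j 1)) (two_I_mul_formalIm (Z 1))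
    rw [coeff_C_mul, him, mul_zero, map_sub, formalConj, coeff_map] at h
    exact (sub_eq_zero.1 h.symm).symm
  have hre : ∀ j, coeff (Finsupp.single j 1) (formalRe (Z 1)) =
      coeff (Finsupp.single j 1) (Z 1) := by
    intro j
    have h := congrArg (coeff (Finsupp.single j 1)) (formalRe_add_I_mul_formalIm (Z 1)).1
    rwa [map_add, coeff_C_mul, him, mul_zero, add_zero] at h
  rw [isUnit_iff_ne_zero]
  intro hdet
  obtain ⟨v, hv, hUv⟩ := Matrix.exists_mulVec_eq_zero_iff.2 hdet
  have h0 : ∑ j, coeff (Finsupp.single j 1) (Z 0) * v j = 0 := congrFun hUv 0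
  have h1 : ∑ j, (starRingEnd ℂ) (coeff (Finsupp.single j 1) (Z 0)) * v j = 0 := by
    have : ∑ j, coeff (Finsupp.single j 1) (formalConj (Z 0)) * v j = 0 := congrFun hUv 1
    simpa only [formalConj, coeff_map] using this
  have h2 : ∑ j, coeff (Finsupp.single j 1) (Z 1) * v j = 0 := by
    have : ∑ j, coeff (Finsupp.single j 1) (formalRe (Z 1)) * v j = 0 := congrFun hUv 2
    simpa only [hre] using this
  have h1' : ∑ j, coeff (Finsupp.single j 1) (Z 0) * (starRingEnd ℂ) (v j) = 0 := by
    have := congrArg (starRingEnd ℂ) h1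
    simpa only [map_sum, map_mul, Complex.conj_conj, map_zero] using this
  have h2' : ∑ j, coeff (Finsupp.single j 1) (Z 1) * (starRingEnd ℂ) (v j) = 0 := by
    have := congrArg (starRingEnd ℂ) h2
    simpa only [map_sum, map_mul, hconj, map_zero] using this
  have himm := Fintype.linearIndependent_iff.1 hZ.embedding.immersion
  have hker : ∀ (x : Fin 3 → ℝ) (α : ℂ), (∀ j, (x j : ℂ) =
      α * v j + (starRingEnd ℂ) α * (starRingEnd ℂ) (v j)) → ∀ j, x j = 0 := by
    intro x α hx
    apply himm
    funext i
    simp only [Finset.sum_apply, Pi.smul_apply, Complex.real_smul, hx, Pi.zero_apply]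
    have hsum : ∀ c : Fin 3 → ℂ, ∑ j, c j * v j = 0 → ∑ j, c j * (starRingEnd ℂ) (v j) = 0 →
        ∑ j, (α * v j + (starRingEnd ℂ) α * (starRingEnd ℂ) (v j)) * c j = 0 := by
      intro c hc hc'
      calc _ = α * ∑ j, c j * v j + (starRingEnd ℂ) α * ∑ j, c j * (starRingEnd ℂ) (v j) := by
            rw [Finset.mul_sum, Finset.mul_sum, ← Finset.sum_add_distrib]
            exact Finset.sum_congr rfl fun j _ => by ring
        _ = 0 := by rw [hc, hc', mul_zero, mul_zero, add_zero]
    fin_cases i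
    · exact hsum _ h0 h1'
    · exact hsum _ h2 h2'
  -- the real and imaginary parts of a vector in the kernel lie in the real kernel
  have hr := hker (fun j => 2 * (v j).re) 1 (fun j => by
    apply Complex.ext <;> simp
    ring)
  have hi := hker (fun j => 2 * (v j).im) (-Complex.I) (fun j => by
    apply Complex.ext <;> simp
    ring)
  exact hv (funext fun j => Complex.ext (by simpa using hr j) (by simpa using hi j))

/-- The transformation law holds identically in the parameters `(z, ζ, s)`, and so at every formal
point of the complexified hypersurface. -/
theorem graphDefect_eq_zero (hZ : IsChernMoserCoordinates M Z A)
    (hZstar : IsChernMoserCoordinates M Zstar Astar) (hH : ∀ i, constantCoeff (H i) = 0)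
    (hHZ : ∀ i, Zstar i = subst Z (H i)) {τ : Type*} {b : Fin 3 → MvPowerSeries τ ℂ}
    (hb : ∀ i, constantCoeff (b i) = 0) : graphDefect H A Astar b = 0 := by
  have hX : ∀ i : Fin 3, constantCoeff (X i : MvPowerSeries (Fin 3) ℂ) = 0 := by simp
  have key : ∀ {υ : Type _} {a : Fin 3 → MvPowerSeries υ ℂ}, (∀ i, constantCoeff (a i) = 0) →
      subst a (graphDefect H A Astar X) = graphDefect H A Astar a := by
    intro υ a ha
    have hs := hasSubst_of_constantCoeff_zero ha
    rw [subst_graphDefect hZ.normalForm hH hX hs]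
    simp only [subst_X hs]
  have hu := constantCoeff_graphParam hZ.embedding.map_base
  have h0 : graphDefect H A Astar (X : Fin 3 → MvPowerSeries (Fin 3) ℂ) = 0 := by
    have hs := hasSubst_of_constantCoeff_zero hu
    refine eq_zero_of_subst_eq_zero_of_isUnit_det hu (isUnit_det_graphParam hZ) ?_
    rw [subst_graphDefect hZ.normalForm hH hX hs]
    simp only [subst_X hs]
    exact graphDefect_graphParam hZ hZstar hHZ
  rw [← key hb, h0, ← coe_substAlgHom (hasSubst_of_constantCoeff_zero hb), map_zero]

end Jacobian

/-! ### Substitution modulo `(z³, ζ⁵)` -/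

/-- The bidegree `(i, j)` as an exponent of two variables. -/
noncomputable def bidegree (i j : ℕ) : Fin 2 →₀ ℕ :=
  Finsupp.equivFunOnFinite.symm ![i, j]

theorem bidegree_eq_iff {i j : ℕ} {d : Fin 2 →₀ ℕ} : bidegree i j = d ↔ d 0 = i ∧ d 1 = j := by
  constructor
  · rintro rfl
    exact ⟨rfl, rfl⟩
  · rintro ⟨rfl, rfl⟩
    ext k
    fin_cases k <;> rfl

theorem bidegree_one_zero : bidegree 1 0 = Finsupp.single 0 1 :=
  bidegree_eq_iff.2 (by simp)

theorem bidegree_zero_one : bidegree 0 1 = Finsupp.single 1 1 :=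
  bidegree_eq_iff.2 (by simp)

theorem bidegree_zero_zero : bidegree 0 0 = 0 :=
  bidegree_eq_iff.2 (by simp)

theorem monomial_bidegree (i j : ℕ) (c : ℂ) :
    (C c * (X 0 ^ i * X 1 ^ j) : MvPowerSeries (Fin 2) ℂ) = monomial (bidegree i j) c := by
  have h : bidegree i j = Finsupp.single 0 i + Finsupp.single 1 j := bidegree_eq_iff.2 (by simp)
  rw [X_pow_eq, X_pow_eq, monomial_mul_monomial, ← monomial_zero_eq_C_apply,
    monomial_mul_monomial, zero_add, mul_one, mul_one, h]

/-- The ideal `(z³, ζ⁵)` of `ℂ⟦z, ζ⟧`, by its coefficients. -/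
noncomputable def truncIdeal : Ideal (MvPowerSeries (Fin 2) ℂ) where
  carrier := {y | ∀ e : Fin 2 →₀ ℕ, e 0 ≤ 2 → e 1 ≤ 4 → coeff e y = 0}
  add_mem' hx hy e h0 h1 := by rw [map_add, hx e h0 h1, hy e h0 h1, add_zero]
  zero_mem' e _ _ := map_zero _
  smul_mem' c x hx e h0 h1 := by
    rw [smul_eq_mul, coeff_mul]
    refine Finset.sum_eq_zero fun p hp => ?_
    have h := Finset.HasAntidiagonal.mem_antidiagonal.1 hp
    have h0' := DFunLike.congr_fun h 0
    have h1' := DFunLike.congr_fun h 1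
    simp only [Finsupp.add_apply] at h0' h1'
    rw [hx p.2 (by omega) (by omega), mul_zero]

theorem mem_truncIdeal {y : MvPowerSeries (Fin 2) ℂ} :
    y ∈ truncIdeal ↔ ∀ e : Fin 2 →₀ ℕ, e 0 ≤ 2 → e 1 ≤ 4 → coeff e y = 0 := Iff.rfl

/-- The ring `ℂ[z, ζ] / (z³, ζ⁵)`. -/
abbrev TruncRing : Type := MvPowerSeries (Fin 2) ℂ ⧸ truncIdeal

/-- Truncation `ℂ⟦z, ζ⟧ → ℂ[z, ζ] / (z³, ζ⁵)`. -/
noncomputable abbrev toTrunc : MvPowerSeries (Fin 2) ℂ →+* TruncRing :=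
  Ideal.Quotient.mk truncIdeal

namespace TruncRing

/-- The constants in `ℂ[z, ζ] / (z³, ζ⁵)`. -/
noncomputable abbrev const : ℂ →+* TruncRing := toTrunc.comp C

/-- The class of the first variable. -/
noncomputable abbrev z : TruncRing := toTrunc (X 0)

/-- The class of the second variable. -/
noncomputable abbrev ζ : TruncRing := toTrunc (X 1)

theorem z_pow_three : z ^ 3 = 0 := by
  rw [z, ← map_pow, Ideal.Quotient.eq_zero_iff_mem, mem_truncIdeal]
  intro e h0 _
  exact X_pow_dvd_iff.1 (dvd_refl (X 0 ^ 3 : MvPowerSeries (Fin 2) ℂ)) e (by omega)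

theorem ζ_pow_five : ζ ^ 5 = 0 := by
  rw [ζ, ← map_pow, Ideal.Quotient.eq_zero_iff_mem, mem_truncIdeal]
  intro e _ h1
  exact X_pow_dvd_iff.1 (dvd_refl (X 1 ^ 5 : MvPowerSeries (Fin 2) ℂ)) e (by omega)

/-- `z² ζ⁴` spans the socle: it is annihilated by every series without constant term. -/
theorem socle_mul {r : MvPowerSeries (Fin 2) ℂ} (hr : constantCoeff r = 0) :
    z ^ 2 * ζ ^ 4 * toTrunc r = 0 := by
  rw [z, ζ, ← map_pow, ← map_pow, ← map_mul, ← map_mul, Ideal.Quotient.eq_zero_iff_mem,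
    mem_truncIdeal]
  intro e h0 h1
  have h := monomial_bidegree 2 4 1
  rw [map_one, one_mul] at h
  rw [h, coeff_monomial_mul]
  split_ifs with hle
  · have h0' := hle 0
    have h1' := hle 1
    have : bidegree 2 4 = e := by
      refine bidegree_eq_iff.2 ⟨?_, ?_⟩
      · exact le_antisymm h0 h0'
      · exact le_antisymm h1 h1'
    rw [this, tsub_self, coeff_zero_eq_constantCoeff_apply, hr, mul_zero]
  · rfl

/-- The monomials `z ^ i ζ ^ j` with `i ≤ 2` and `j ≤ 4` are linearly independent. -/
theorem coeff_eq_zero {c : Fin 3 → Fin 5 → ℂ}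
    (h : ∑ i, ∑ j, const (c i j) * (z ^ (i : ℕ) * ζ ^ (j : ℕ)) = 0) (i : Fin 3) (j : Fin 5) :
    c i j = 0 := by
  have h' : toTrunc (∑ i, ∑ j, C (c i j) * (X 0 ^ (i : ℕ) * X 1 ^ (j : ℕ))) = 0 := by
    simpa only [map_sum, map_mul, map_pow, RingHom.comp_apply] using h
  rw [Ideal.Quotient.eq_zero_iff_mem, mem_truncIdeal] at h'
  have h2 := h' (bidegree i j) (Nat.lt_succ_iff.1 i.2) (Nat.lt_succ_iff.1 j.2)
  simp only [monomial_bidegree, map_sum, coeff_monomial] at h2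
  rw [Finset.sum_eq_single i, Finset.sum_eq_single j, if_pos rfl] at h2
  · exact h2
  · intro k _ hk
    rw [if_neg]
    intro hh
    exact hk (Fin.ext (bidegree_eq_iff.1 hh.symm).2.symm)
  · simp
  · intro k _ hk
    refine Finset.sum_eq_zero fun l _ => ?_
    rw [if_neg]
    intro hh
    exact hk (Fin.ext (bidegree_eq_iff.1 hh.symm).1.symm)
  · simp

/-- A substitution into `F`, modulo `(z³, ζ⁵)`, may be computed from finitely many terms of `F`. -/
theorem toTrunc_subst {σ : Type*} [Fintype σ] {a : σ → MvPowerSeries (Fin 2) ℂ}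
    (ha : HasSubst a) (F : MvPowerSeries σ ℂ) (S : Finset (σ →₀ ℕ))
    (h : ∀ d ∉ S, coeff d F = 0 ∨ ∏ i, toTrunc (a i) ^ d i = 0) :
    toTrunc (subst a F) = ∑ d ∈ S, const (coeff d F) * ∏ i, toTrunc (a i) ^ d i := by
  have hS : toTrunc (∑ d ∈ S, C (coeff d F) * ∏ i, a i ^ d i) =
      ∑ d ∈ S, const (coeff d F) * ∏ i, toTrunc (a i) ^ d i := by
    simp only [map_sum, map_mul, map_prod, map_pow, RingHom.comp_apply]
  rw [← hS, Ideal.Quotient.eq, mem_truncIdeal]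
  intro e h0 h1
  rw [map_sub, sub_eq_zero, coeff_subst ha, finsum_eq_sum_of_support_subset (s := S)]
  · rw [map_sum]
    refine Finset.sum_congr rfl fun d _ => ?_
    rw [coeff_C_mul, Finsupp.prod_fintype _ _ (fun _ => pow_zero _), smul_eq_mul]
  · intro d hd
    by_contra hdS
    apply hd
    dsimp only
    rw [Finsupp.prod_fintype _ _ (fun _ => pow_zero _)]
    rcases h d hdS with h2 | h2
    · simp only [h2, zero_smul]
    · have h3 : toTrunc (∏ i, a i ^ d i) = 0 := by
        simpa only [map_prod, map_pow] using h2
      rw [Ideal.Quotient.eq_zero_iff_mem, mem_truncIdeal] at h3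
      simp only [h3 e h0 h1, smul_zero]

theorem toTrunc_subst_pair {x y : MvPowerSeries (Fin 2) ℂ} (hx : constantCoeff x = 0)
    (hy : constantCoeff y = 0) (F : MvPowerSeries (Fin 2) ℂ) (T : Finset (ℕ × ℕ))
    (h : ∀ i j, (i, j) ∉ T → coeff (bidegree i j) F = 0 ∨ toTrunc x ^ i * toTrunc y ^ j = 0) :
    toTrunc (subst ![x, y] F) =
      ∑ p ∈ T, const (coeff (bidegree p.1 p.2) F) * (toTrunc x ^ p.1 * toTrunc y ^ p.2) := by
  classical
  have hinj : Set.InjOn (fun p : ℕ × ℕ => bidegree p.1 p.2) T := by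
    intro p _ q _ hpq
    obtain ⟨h1, h2⟩ := bidegree_eq_iff.1 hpq
    exact Prod.ext h1.symm h2.symm
  rw [toTrunc_subst (hasSubst_pair hx hy) F (T.image fun p => bidegree p.1 p.2),
    Finset.sum_image hinj]
  · refine Finset.sum_congr rfl fun p _ => ?_
    rw [Fin.prod_univ_two]
    rfl
  · intro d hd
    have hd' : bidegree (d 0) (d 1) = d := bidegree_eq_iff.2 ⟨rfl, rfl⟩
    rw [Fin.prod_univ_two]
    have h1 := h (d 0) (d 1) fun hT => hd (Finset.mem_image.2 ⟨_, hT, hd'⟩)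
    rwa [hd'] at h1

/-- If `ω` is divisible by `z`, then `F(z, ω)` is determined modulo `z³` by the `2`-jet of `F`. -/
theorem toTrunc_subst_of_dvd {y : MvPowerSeries (Fin 2) ℂ} (hy : constantCoeff y = 0)
    {ξ : TruncRing} (hξ : toTrunc y = z * ξ) {F : MvPowerSeries (Fin 2) ℂ}
    (hF : constantCoeff F = 0) :
    toTrunc (subst ![X 0, y] F) = z * (const (coeff (bidegree 1 0) F) +
      const (coeff (bidegree 0 1) F) * ξ + z * (const (coeff (bidegree 2 0) F) +
        const (coeff (bidegree 1 1) F) * ξ + const (coeff (bidegree 0 2) F) * ξ ^ 2)) := by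
  rw [toTrunc_subst_pair (by simp) hy F {(1, 0), (0, 1), (2, 0), (1, 1), (0, 2)}]
  · rw [Finset.sum_insert (by decide), Finset.sum_insert (by decide),
      Finset.sum_insert (by decide), Finset.sum_insert (by decide), Finset.sum_singleton, hξ]
    ring
  · intro i j hij
    rcases lt_or_ge (i + j) 3 with h | h
    · left
      have hi : i < 3 := by omega
      have hj : j < 3 := by omega
      interval_cases i <;> interval_cases j <;> first
        | exact absurd (by decide) hij
        | omega
        | rwa [bidegree_zero_zero, coeff_zero_eq_constantCoeff_apply]
    · right
      obtain ⟨k, hk⟩ := Nat.exists_eq_add_of_le h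
      rw [hξ, mul_pow, ← mul_assoc, ← pow_add, hk, pow_add]
      change z ^ 3 * _ * _ = 0
      rw [z_pow_three, zero_mul, zero_mul]

/-- If `ω` is a multiple of `z² ζ⁴`, it enters `F(ζ, ω)` only through the linear term of `F`. -/
theorem toTrunc_subst_of_socle {y : MvPowerSeries (Fin 2) ℂ} (hy : constantCoeff y = 0)
    {c : TruncRing} (hc : toTrunc y = c * (z ^ 2 * ζ ^ 4)) {F : MvPowerSeries (Fin 2) ℂ}
    (hF : constantCoeff F = 0) :
    toTrunc (subst ![X 1, y] F) = const (coeff (bidegree 1 0) F) * ζ +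
      const (coeff (bidegree 2 0) F) * ζ ^ 2 + const (coeff (bidegree 3 0) F) * ζ ^ 3 +
      const (coeff (bidegree 4 0) F) * ζ ^ 4 +
      const (coeff (bidegree 0 1) F) * (c * (z ^ 2 * ζ ^ 4)) := by
  rw [toTrunc_subst_pair (by simp) hy F {(1, 0), (2, 0), (3, 0), (4, 0), (0, 1)}]
  · rw [Finset.sum_insert (by decide), Finset.sum_insert (by decide),
      Finset.sum_insert (by decide), Finset.sum_insert (by decide), Finset.sum_singleton, hc]
    ring
  · intro i j hij
    have h5 := ζ_pow_five
    rw [hc]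
    change _ ∨ ζ ^ i * _ = 0
    rcases Nat.lt_or_ge 4 i with hi | hi
    · right
      obtain ⟨k, rfl⟩ := Nat.exists_eq_add_of_le (show 5 ≤ i by omega)
      rw [pow_add, h5, zero_mul, zero_mul]
    · rcases Nat.lt_or_ge 1 j with hj | hj
      · right
        obtain ⟨k, rfl⟩ := Nat.exists_eq_add_of_le (show 2 ≤ j by omega)
        have : (c * (z ^ 2 * ζ ^ 4)) ^ 2 = 0 := by
          linear_combination (c ^ 2 * z ^ 4 * ζ ^ 3) * h5
        rw [pow_add, this, zero_mul, mul_zero]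
      · have hi' : i < 5 := by omega
        have hj' : j < 2 := by omega
        interval_cases i <;> interval_cases j <;> first
          | exact absurd (by decide) hij
          | (left; rwa [bidegree_zero_zero, coeff_zero_eq_constantCoeff_apply])
          | (right; linear_combination (c * z ^ 2) * h5)
          | (right; linear_combination (c * z ^ 2 * ζ) * h5)
          | (right; linear_combination (c * z ^ 2 * ζ ^ 2) * h5)
          | (right; linear_combination (c * z ^ 2 * ζ ^ 3) * h5)

/-- Since `A₂₂ = A₂₃ = 0`, the terms of order at least four of a normal form reduce modulo
`(z³, ζ⁵)` to `c z² ζ⁴`, where `c` is the Cartan coefficient; here `z p` and `ζ q` are substituted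
for `z` and `ζ`. -/
theorem toTrunc_subst_graphSeries {A : ℕ → ℕ → PowerSeries ℂ} (hA : IsChernMoserNormalForm A)
    {x y t : MvPowerSeries (Fin 2) ℂ} (hx : constantCoeff x = 0) (hy : constantCoeff y = 0)
    (ht : constantCoeff t = 0) {p q : TruncRing} (hp : toTrunc x = z * p)
    (hq : toTrunc y = ζ * q) :
    toTrunc (subst ![x, y, t] (graphSeries A)) =
      const (cartanCoeff A) * (p ^ 2 * q ^ 4 * (z ^ 2 * ζ ^ 4)) := by
  rw [toTrunc_subst (hasSubst_triple hx hy ht) _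
    {Finsupp.equivFunOnFinite.symm (![2, 4, 0] : Fin 3 → ℕ)}]
  · rw [Finset.sum_singleton, Fin.prod_univ_three]
    change const (PowerSeries.coeff 0 (A 2 4)) *
      (toTrunc x ^ 2 * toTrunc y ^ 4 * toTrunc t ^ 0) = _
    rw [hp, hq, cartanCoeff, PowerSeries.coeff_zero_eq_constantCoeff_apply]
    ring
  · intro d hd
    rw [Fin.prod_univ_three]
    change PowerSeries.coeff (d 2) (A (d 0) (d 1)) = 0 ∨
      toTrunc x ^ d 0 * toTrunc y ^ d 1 * toTrunc t ^ d 2 = 0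
    have hd' : ¬ (d 0 = 2 ∧ d 1 = 4 ∧ d 2 = 0) := by
      rintro ⟨h0, h1, h2⟩
      apply hd
      rw [Finset.mem_singleton]
      ext k
      fin_cases k
      · exact h0
      · exact h1
      · exact h2
    rw [hp, hq]
    generalize d 0 = k at *
    generalize d 1 = l at *
    generalize d 2 = m at *
    by_cases hlt : k < 2 ∨ l < 2
    · left
      rw [hA.zero_of_lt _ _ hlt, map_zero]
    by_cases hk : 3 ≤ k
    · right
      obtain ⟨n, rfl⟩ := Nat.exists_eq_add_of_le hk
      rw [mul_pow, pow_add z, z_pow_three]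
      ring
    by_cases hl : 5 ≤ l
    · right
      obtain ⟨n, rfl⟩ := Nat.exists_eq_add_of_le hl
      rw [mul_pow ζ, pow_add ζ, ζ_pow_five]
      ring
    obtain rfl : k = 2 := by omega
    have hl' : l = 2 ∨ l = 3 ∨ l = 4 := by omega
    rcases hl' with rfl | rfl | rfl
    · left; rw [hA.A22, map_zero]
    · left; rw [hA.A23, map_zero]
    · right
      obtain ⟨n, rfl⟩ := Nat.exists_eq_succ_of_ne_zero (show m ≠ 0 by omega)
      have := socle_mul ht
      rw [Nat.succ_eq_add_one, pow_succ]
      linear_combination (p ^ 2 * q ^ 4 * toTrunc t ^ n) * this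

end TruncRing

/-! ### Comparison of coefficients -/

theorem socle_pow_mul_pow {R : Type*} [CommRing R] {z ζ : R} (hz : z ^ 3 = 0) (hζ : ζ ^ 5 = 0)
    (f b p₁ p₂ q : R) :
    (f + ζ * p₁ + z * p₂) ^ 2 * (b + ζ * q) ^ 4 * (z ^ 2 * ζ ^ 4) =
      f ^ 2 * b ^ 4 * (z ^ 2 * ζ ^ 4) := by
  have h1 : (z ^ 2 * ζ ^ 4) * (f + ζ * p₁ + z * p₂) = (z ^ 2 * ζ ^ 4) * f := by
    linear_combination (z ^ 2 * p₁) * hζ + (ζ ^ 4 * p₂) * hz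
  have h2 : (z ^ 2 * ζ ^ 4) * (b + ζ * q) = (z ^ 2 * ζ ^ 4) * b := by
    linear_combination (z ^ 2 * q) * hζ
  generalize f + ζ * p₁ + z * p₂ = P at h1 ⊢
  generalize b + ζ * q = Q at h2 ⊢
  linear_combination ((P + f) * Q ^ 4) * h1 +
    f ^ 2 * (Q ^ 3 + Q ^ 2 * b + Q * b ^ 2 + b ^ 3) * h2

section Segre

open TruncRing

variable {A Astar : ℕ → ℕ → PowerSeries ℂ} {H : Fin 2 → MvPowerSeries (Fin 2) ℂ}

/-- The equations obtained by comparing coefficients of `z^i ζ^j`, `i ≤ 2`, `j ≤ 4`, in the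
transformation law along the points `(z, ζ, s) = (z, ζ, i z ζ)`, which approximate the Segre
variety `w̄ = 0`. -/
theorem relations_of_graphDefect_eq_zero (hA : IsChernMoserNormalForm A)
    (hAstar : IsChernMoserNormalForm Astar) (hH : ∀ i, constantCoeff (H i) = 0)
    (hdef : graphDefect H A Astar
      (![X 0, X 1, C Complex.I * (X 0 * X 1)] : Fin 3 → MvPowerSeries (Fin 2) ℂ) = 0)
    {f g b h : ℕ → ℕ → ℂ} (hf : ∀ i j, f i j = coeff (bidegree i j) (H 0))
    (hg : ∀ i j, g i j = coeff (bidegree i j) (H 1))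
    (hb : ∀ i j, b i j = (starRingEnd ℂ) (f i j)) (hh : ∀ i j, h i j = (starRingEnd ℂ) (g i j)) :
    g 1 0 = 0 ∧ g 0 1 = f 1 0 * b 1 0 ∧
      f 1 0 * b 2 0 + 2 * Complex.I * f 0 1 * b 1 0 = 0 ∧
      f 1 0 * b 3 0 + 2 * Complex.I * f 0 1 * b 2 0 = 0 ∧
      f 1 0 * b 4 0 + 2 * Complex.I * f 0 1 * b 3 0 = 0 ∧
      f 2 0 * b 3 0 + 2 * Complex.I * f 1 1 * b 2 0 - 4 * f 0 2 * b 1 0 = 0 ∧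
      cartanCoeff A * (g 0 1 + h 0 1) =
        2 * (f 2 0 * b 4 0 + 2 * Complex.I * f 1 1 * b 3 0 - 4 * f 0 2 * b 2 0) +
          2 * cartanCoeff Astar * f 1 0 ^ 2 * b 1 0 ^ 4 := by
  set a : Fin 3 → MvPowerSeries (Fin 2) ℂ := ![X 0, X 1, C Complex.I * (X 0 * X 1)] with ha_def
  have ha : ∀ i, constantCoeff (a i) = 0 := by
    intro i
    fin_cases i <;> simp [a]
  obtain ⟨hw, hw'⟩ := constantCoeff_graphCoord hA ha
  have hH' : ∀ i, constantCoeff (map (starRingEnd ℂ) (H i)) = 0 := by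
    intro i; simp [hH]
  have hz := z_pow_three
  have hζ := ζ_pow_five
  set ι : TruncRing := const Complex.I with hι
  have hι2 : ι ^ 2 = -1 := by
    rw [hι, ← map_pow, Complex.I_sq, map_neg, map_one]
  set c : TruncRing := const (cartanCoeff A) with hc
  have hN : toTrunc (subst a (graphSeries A)) = c * (z ^ 2 * ζ ^ 4) := by
    have h := toTrunc_subst_graphSeries hA (ha 0) (ha 1) (ha 2) (p := 1) (q := 1)
      (mul_one _).symm (mul_one _).symm
    rw [one_pow, one_pow, one_mul, one_mul] at h
    exact h
  have hω : toTrunc (graphCoord A a) = z * (2 * ι * ζ + ι * c * z * ζ ^ 4) := by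
    rw [graphCoord, map_add, map_mul, map_add, map_mul, hN]
    change toTrunc (C Complex.I * (X 0 * X 1)) + const Complex.I * (z * ζ + _) = _
    rw [map_mul, map_mul]
    change ι * (z * ζ) + ι * (z * ζ + _) = _
    ring
  have hω' : toTrunc (graphCoordConj A a) = (-(ι * c)) * (z ^ 2 * ζ ^ 4) := by
    rw [graphCoordConj, map_sub, map_mul, map_add, map_mul, hN]
    change toTrunc (C Complex.I * (X 0 * X 1)) - const Complex.I * (z * ζ + _) = _
    rw [map_mul, map_mul]
    change ι * (z * ζ) - ι * (z * ζ + _) = _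
    ring
  have e1 := fun i => toTrunc_subst_of_dvd hw hω (hH i)
  have e2 := fun i => toTrunc_subst_of_socle hw' hω' (hH' i)
  simp only [coeff_map] at e2
  have h0 := fun i => constantCoeff_subst_pair (ha 0) hw (hH i)
  have k0 := fun i => constantCoeff_subst_pair (ha 1) hw' (hH' i)
  have ht : constantCoeff (C (1 / 2) * (subst ![a 0, graphCoord A a] (H 1) +
      subst ![a 1, graphCoordConj A a] (map (starRingEnd ℂ) (H 1)))) = 0 := by
    rw [map_mul, map_add, h0, k0]; simp
  have e3 := toTrunc_subst_graphSeries hAstar (h0 0) (k0 0) ht (e1 0)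
    (q := const (b 1 0) + ζ * (const (b 2 0) + const (b 3 0) * ζ +
      const (b 4 0) * ζ ^ 2 + const (b 0 1) * (-(ι * c)) * (z ^ 2 * ζ ^ 2)))
    (by
      refine (e2 0).trans ?_
      simp only [hb, hf]
      ring)
  have hD := congrArg toTrunc hdef
  simp only [graphDefect, map_sub, map_add, map_mul toTrunc, map_zero toTrunc] at hD
  have E0 := (e1 0).trans (show _ = const (f 1 0) * z + 2 * ι * const (f 0 1) * (z * ζ) +
      z ^ 2 * (const (f 2 0) + 2 * ι * const (f 1 1) * ζ - 4 * const (f 0 2) * ζ ^ 2 +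
        ι * c * const (f 0 1) * ζ ^ 4) by
    simp only [← hf]
    linear_combination (const (f 1 1) * ι * c * ζ ^ 4 + const (f 0 2) *
      (4 * ι ^ 2 * c * ζ ^ 5 + ι ^ 2 * c ^ 2 * z * ζ ^ 8)) * hz +
      (4 * const (f 0 2) * z ^ 2 * ζ ^ 2) * hι2)
  have E1 := (e1 1).trans (show _ = const (g 1 0) * z + 2 * ι * const (g 0 1) * (z * ζ) +
      z ^ 2 * (const (g 2 0) + 2 * ι * const (g 1 1) * ζ - 4 * const (g 0 2) * ζ ^ 2 +
        ι * c * const (g 0 1) * ζ ^ 4) by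
    simp only [← hg]
    linear_combination (const (g 1 1) * ι * c * ζ ^ 4 + const (g 0 2) *
      (4 * ι ^ 2 * c * ζ ^ 5 + ι ^ 2 * c ^ 2 * z * ζ ^ 8)) * hz +
      (4 * const (g 0 2) * z ^ 2 * ζ ^ 2) * hι2)
  have K0 := e2 0
  have K1 := e2 1
  simp only [← hf, ← hb] at K0
  simp only [← hg, ← hh] at K1
  have E3 := e3.trans (show _ = const (cartanCoeff Astar) *
      (const (f 1 0) ^ 2 * const (b 1 0) ^ 4 * (z ^ 2 * ζ ^ 4)) by
    rw [← socle_pow_mul_pow hz hζ (const (f 1 0)) (const (b 1 0))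
      (const (f 0 1) * (2 * ι + ι * c * z * ζ ^ 3))]
    simp only [← hf]
    congr 5
    ring)
  rw [E3] at hD
  rw [show toTrunc (subst ![a 0, graphCoord A a] (H 0)) = _ from E0,
    show toTrunc (subst ![a 0, graphCoord A a] (H 1)) = _ from E1,
    show toTrunc (subst ![a 1, graphCoordConj A a] (map (starRingEnd ℂ) (H 0))) = _ from K0,
    show toTrunc (subst ![a 1, graphCoordConj A a] (map (starRingEnd ℂ) (H 1))) = _ from K1]
    at hD
  have h2I : toTrunc (C (2 * Complex.I)) = 2 * ι := by
    change const (2 * Complex.I) = _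
    rw [map_mul, map_ofNat]
  rw [h2I] at hD
  have hI := Complex.I_ne_zero
  have hcoef := TruncRing.coeff_eq_zero (c := ![
    ![0, -h 1 0, -h 2 0, -h 3 0, -h 4 0],
    ![g 1 0, 2 * Complex.I * (g 0 1 - f 1 0 * b 1 0),
      -2 * Complex.I * (f 1 0 * b 2 0 + 2 * Complex.I * f 0 1 * b 1 0),
      -2 * Complex.I * (f 1 0 * b 3 0 + 2 * Complex.I * f 0 1 * b 2 0),
      -2 * Complex.I * (f 1 0 * b 4 0 + 2 * Complex.I * f 0 1 * b 3 0)],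
    ![g 2 0, 2 * Complex.I * (g 1 1 - f 2 0 * b 1 0),
      -4 * g 0 2 - 2 * Complex.I * (f 2 0 * b 2 0 + 2 * Complex.I * f 1 1 * b 1 0),
      -2 * Complex.I * (f 2 0 * b 3 0 + 2 * Complex.I * f 1 1 * b 2 0 - 4 * f 0 2 * b 1 0),
      Complex.I * (cartanCoeff A * (g 0 1 + h 0 1) -
        2 * (f 2 0 * b 4 0 + 2 * Complex.I * f 1 1 * b 3 0 - 4 * f 0 2 * b 2 0) -
          2 * cartanCoeff Astar * f 1 0 ^ 2 * b 1 0 ^ 4)]])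
    (by
      simp only [Fin.sum_univ_succ, Fin.sum_univ_zero, Matrix.cons_val_zero,
        Matrix.cons_val_succ, Fin.val_zero, Fin.val_succ, map_add, map_sub, map_mul, map_neg,
        map_pow, map_zero, map_ofNat, ← hι, ← hc]
      linear_combination hD + (2 * ι) *
        ((-(ι * c) * const (b 0 1) * ζ ^ 4 * (const (f 1 0) + 2 * ι * const (f 0 1) * ζ +
            z * (const (f 2 0) + 2 * ι * const (f 1 1) * ζ - 4 * const (f 0 2) * ζ ^ 2 +
              ι * c * const (f 0 1) * ζ ^ 4))) * hz +
          (2 * ι * const (f 0 1) * z * const (b 4 0) +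
            z ^ 2 * (2 * ι * const (f 1 1) * const (b 4 0) -
              4 * const (f 0 2) * (const (b 3 0) + const (b 4 0) * ζ) +
              ι * c * const (f 0 1) * (const (b 1 0) + const (b 2 0) * ζ + const (b 3 0) * ζ ^ 2 +
                const (b 4 0) * ζ ^ 3))) * hζ))
  have c10 : g 1 0 = 0 := hcoef 1 0
  have c11 : 2 * Complex.I * (g 0 1 - f 1 0 * b 1 0) = 0 := hcoef 1 1
  have c12 : -2 * Complex.I * (f 1 0 * b 2 0 + 2 * Complex.I * f 0 1 * b 1 0) = 0 := hcoef 1 2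
  have c13 : -2 * Complex.I * (f 1 0 * b 3 0 + 2 * Complex.I * f 0 1 * b 2 0) = 0 := hcoef 1 3
  have c14 : -2 * Complex.I * (f 1 0 * b 4 0 + 2 * Complex.I * f 0 1 * b 3 0) = 0 := hcoef 1 4
  have c23 : -2 * Complex.I *
    (f 2 0 * b 3 0 + 2 * Complex.I * f 1 1 * b 2 0 - 4 * f 0 2 * b 1 0) = 0 := hcoef 2 3
  have c24 : Complex.I * (cartanCoeff A * (g 0 1 + h 0 1) -
        2 * (f 2 0 * b 4 0 + 2 * Complex.I * f 1 1 * b 3 0 - 4 * f 0 2 * b 2 0) -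
          2 * cartanCoeff Astar * f 1 0 ^ 2 * b 1 0 ^ 4) = 0 := hcoef 2 4
  have h2 : 2 * Complex.I ≠ 0 := mul_ne_zero two_ne_zero hI
  have h2' : -2 * Complex.I ≠ 0 := mul_ne_zero (by norm_num) hI
  refine ⟨c10, sub_eq_zero.1 ((mul_eq_zero_iff_left h2).1 c11), (mul_eq_zero_iff_left h2').1 c12,
    (mul_eq_zero_iff_left h2').1 c13, (mul_eq_zero_iff_left h2').1 c14,
    (mul_eq_zero_iff_left h2').1 c23, ?_⟩
  linear_combination (mul_eq_zero_iff_left hI).1 c24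

end Segre

/-! ### The transformation of the Cartan coefficient -/

/-- If `exp ℓ = λ² λ̄`, then the power `exp (-ℓ/3 + 5 ℓ̄/3)` is `λ λ̄³`: replacing `ℓ` by
`ℓ + 2πi n` multiplies it by `exp (-4πi n) = 1`. -/
theorem exp_mul_exp_of_exp_eq {l ℓ : ℂ} (hl : l ≠ 0)
    (h : Complex.exp ℓ = l ^ 2 * (starRingEnd ℂ) l) :
    Complex.exp (-(1 / 3) * ℓ) * Complex.exp (5 / 3 * (starRingEnd ℂ) ℓ) =
      l * (starRingEnd ℂ) l ^ 3 := by
  obtain ⟨m, rfl⟩ : ∃ m, Complex.exp m = l := ⟨Complex.log l, Complex.exp_log hl⟩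
  rw [← Complex.exp_conj, ← Complex.exp_nat_mul, ← Complex.exp_add, Complex.exp_eq_exp_iff_exists_int]
    at h
  obtain ⟨n, rfl⟩ := h
  rw [← Complex.exp_conj, ← Complex.exp_nat_mul, ← Complex.exp_add, ← Complex.exp_add,
    Complex.exp_eq_exp_iff_exists_int]
  refine ⟨-2 * n, ?_⟩
  simp only [map_add, map_mul, Complex.conj_conj, Complex.conj_I, Complex.conj_ofReal, map_ofNat,
    map_intCast, map_natCast]
  push_cast
  ring

/-- The transformation law in terms of `λ = ∂f/∂z(0)`, where `H = (f, g)`. -/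
theorem cartanCoeff_eq_of_graphDefect_eq_zero {A Astar : ℕ → ℕ → PowerSeries ℂ}
    {H : Fin 2 → MvPowerSeries (Fin 2) ℂ} (hA : IsChernMoserNormalForm A)
    (hAstar : IsChernMoserNormalForm Astar) (hH : IsFormalBiholomorphism H)
    (hdef : graphDefect H A Astar
      (![X 0, X 1, C Complex.I * (X 0 * X 1)] : Fin 3 → MvPowerSeries (Fin 2) ℂ) = 0) :
    ∃ l : ℂ, l ≠ 0 ∧ (formalJacobian H).det = l ^ 2 * (starRingEnd ℂ) l ∧
      cartanCoeff A = l * (starRingEnd ℂ) l ^ 3 * cartanCoeff Astar := by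
  obtain ⟨hg10, hg01, h12, h13, h14, h23, h24⟩ :=
    relations_of_graphDefect_eq_zero hA hAstar hH.map_zero hdef
      (f := fun i j => coeff (bidegree i j) (H 0)) (g := fun i j => coeff (bidegree i j) (H 1))
      (b := fun i j => (starRingEnd ℂ) (coeff (bidegree i j) (H 0)))
      (h := fun i j => (starRingEnd ℂ) (coeff (bidegree i j) (H 1)))
      (fun _ _ => rfl) (fun _ _ => rfl) (fun _ _ => rfl) (fun _ _ => rfl)
  have hdet : (formalJacobian H).det = coeff (bidegree 1 0) (H 0) ^ 2 *
      (starRingEnd ℂ) (coeff (bidegree 1 0) (H 0)) := by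
    rw [Matrix.det_fin_two]
    simp only [formalJacobian, Matrix.of_apply, ← bidegree_one_zero, ← bidegree_zero_one]
    rw [hg10, hg01]
    ring
  have hl : coeff (bidegree 1 0) (H 0) ≠ 0 := by
    intro h
    apply hH.det_ne_zero
    rw [hdet, h]
    ring
  refine ⟨_, hl, hdet, ?_⟩
  have hlbar : (starRingEnd ℂ) (coeff (bidegree 1 0) (H 0)) ≠ 0 := by simpa using hl
  -- the coefficients `b_{j0}` are in geometric progression, so the obstruction in bidegree `(2, 4)`
  -- is a multiple of the one in bidegree `(2, 3)`
  have hobs : coeff (bidegree 2 0) (H 0) * (starRingEnd ℂ) (coeff (bidegree 4 0) (H 0)) +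
      2 * Complex.I * coeff (bidegree 1 1) (H 0) *
        (starRingEnd ℂ) (coeff (bidegree 3 0) (H 0)) -
      4 * coeff (bidegree 0 2) (H 0) * (starRingEnd ℂ) (coeff (bidegree 2 0) (H 0)) = 0 := by
    apply (mul_eq_zero_iff_left hl).1
    linear_combination coeff (bidegree 2 0) (H 0) * h14 +
      2 * Complex.I * coeff (bidegree 1 1) (H 0) * h13 - 4 * coeff (bidegree 0 2) (H 0) * h12 -
      2 * Complex.I * coeff (bidegree 0 1) (H 0) * h23
  rw [hobs, hg01, map_mul, Complex.conj_conj] at h24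
  refine mul_left_cancel₀ (mul_ne_zero (mul_ne_zero two_ne_zero hl) hlbar) ?_
  linear_combination h24

/-- The fractional powers of `D = det H_Z(0)` and of its conjugate are formed with one and the same
(arbitrary) branch of the logarithm: if `exp ℓ = D`, then `D ^ a` is `exp (a ℓ)` and
`(conj D) ^ a` is `exp (a * conj ℓ)`. -/
theorem proposition2p1 (M : FormalCRGerm)
    (Z Zstar : Fin 2 → MvPowerSeries (Fin 3) ℂ) (A Astar : ℕ → ℕ → PowerSeries ℂ)
    (hZ : IsChernMoserCoordinates M Z A) (hZstar : IsChernMoserCoordinates M Zstar Astar)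
    (H : Fin 2 → MvPowerSeries (Fin 2) ℂ) (hH : IsFormalBiholomorphism H)
    (hHZ : ∀ i, Zstar i = MvPowerSeries.subst Z (H i)) :
    (∀ ℓ : ℂ, Complex.exp ℓ = (formalJacobian H).det →
      cartanCoeff A =
        Complex.exp (-(1 / 3) * ℓ) * Complex.exp (5 / 3 * (starRingEnd ℂ) ℓ) *
          cartanCoeff Astar) ∧
    (cartanCoeff A = 0 ↔ cartanCoeff Astar = 0) := by
  obtain ⟨l, hl, hdet, hc⟩ := cartanCoeff_eq_of_graphDefect_eq_zero hZ.normalForm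
    hZstar.normalForm hH (graphDefect_eq_zero hZ hZstar hH.map_zero hHZ
      (by intro i; fin_cases i <;> simp))
  have hlbar : (starRingEnd ℂ) l ≠ 0 := by simpa using hl
  refine ⟨fun ℓ hℓ => ?_, ?_⟩
  · rw [exp_mul_exp_of_exp_eq hl (hℓ.trans hdet), hc]
  · rw [hc, mul_eq_zero_iff_left (mul_ne_zero hl (pow_ne_zero 3 hlbar))]
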